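/- Let $(r_i)_{i\in\mathbb N}$ be a computable sequence of positive rational numbers such that the series $\sum_i r_i$ converges, and let $\alpha=\sum_i r_i$ be its sum. Let $m$ be a universal semimeasure on $\mathbb N$, that is, a lower semicomputable semimeasure that is maximal up to a constant factor: for every lower semicomputable semimeasure $m'$ there is a constant $C>0$ with $m'_i\le C\,m_i$ for all $i$. (A lower semicomputable semimeasure is a function $m\colon\mathbb N\to[0,\infty)$ with $\sum_i m_i\le 1$ such that, uniformly in $i$, the value $m_i$ is the limit of a computable non-decreasing sequence of rational numbers.) The series is said to have the Solovay property if there is $\varepsilon>0$ such that $r_i\ge\varepsilon\, m_i$ for infinitely many $i$. Then $\alpha$ is Martin-Löf random if and only if the series $\sum_i r_i$ has the Solovay property. Equivalently, $\alpha$ is not Martin-Löf random if and only if $r_i/m_i\to 0$ as $i\to\infty$. Here a real number $x$ is Martin-Löf random if $x\notin\bigcap_n U_n$ for every sequence of sets $U_n=\bigcup_k (a_{n,k},b_{n,k})\subseteq\mathbb R$ with rational endpoints $a_{n,k},b_{n,k}$ computable in $(n,k)$ (an interval with $b_{n,k}\le a_{n,k}$ being empty) and with Lebesgue measure $\lambda(U_n)\le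 2^{-n}$ for all $n$. -/

import Mathlib

open Filter Topology MeasureTheory

/-- A rational-valued function `f` is computable: there is an algorithm that, given `x`, outputs
`f x` as a fraction `(a - b) / (d + 1)` with natural numbers `a`, `b`, `d`. -/
def IsComputableRat {α : Type*} [Primcodable α] (f : α → ℚ) : Prop :=
  ∃ a b d : α → ℕ, Computable a ∧ Computable b ∧ Computable d ∧
    ∀ x, f x = ((a x : ℚ) - (b x : ℚ)) / ((d x : ℚ) + 1)

/-- A function `m : ℕ → ℝ` is lower semicomputable: uniformly in `i`, the value `m i` is the limit
of a computable increasing sequence of rationals. -/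
def IsLowerSemicomputable (m : ℕ → ℝ) : Prop :=
  ∃ q : ℕ → ℕ → ℚ, IsComputableRat (fun p : ℕ × ℕ => q p.1 p.2) ∧
    ∀ i, Monotone (q i) ∧ Tendsto (fun n => (q i n : ℝ)) atTop (𝓝 (m i))

/-- Lower semicomputable semimeasures on `ℕ`. -/
structure IsLowerSemicomputableSemimeasure (m : ℕ → ℝ) : Prop where
  lowerSemicomputable : IsLowerSemicomputable m
  nonneg : ∀ i, 0 ≤ m i
  summable : Summable m
  tsum_le_one : ∑' i, m i ≤ 1

/-- Universal semimeasures: the lower semicomputable semimeasures that are maximal up to a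
constant factor. -/
structure IsUniversalSemimeasure (m : ℕ → ℝ) : Prop where
  isSemimeasure : IsLowerSemicomputableSemimeasure m
  maximal : ∀ m' : ℕ → ℝ, IsLowerSemicomputableSemimeasure m' →
    ∃ C : ℝ, 0 < C ∧ ∀ i, m' i ≤ C * m i

/-- A Martin-Löf test on the real line: a sequence of uniformly effectively open sets `U n` with
Lebesgue measure at most `2⁻ⁿ`. Each `U n` is the union of a sequence of open intervals whose
rational endpoints are computable uniformly in `n` (`Set.Ioo a b` is empty if `b ≤ a`). -/
def IsMartinLofTest (U : ℕ → Set ℝ) : Prop :=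
  (∃ a b : ℕ → ℕ → ℚ,
    IsComputableRat (fun p : ℕ × ℕ => a p.1 p.2) ∧
    IsComputableRat (fun p : ℕ × ℕ => b p.1 p.2) ∧
    ∀ n, U n = ⋃ k, Set.Ioo (a n k : ℝ) (b n k : ℝ)) ∧
  ∀ n, volume (U n) ≤ (2⁻¹ : ENNReal) ^ n

/-- A real number is Martin-Löf random if it is not covered by all the sets of any
Martin-Löf test. -/
def IsMartinLofRandom (x : ℝ) : Prop :=
  ∀ U : ℕ → Set ℝ, IsMartinLofTest U → x ∉ ⋂ n, U n

/-- The Solovay property of the series `∑ r i` with respect to a (universal) semimeasure `m`: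
for some `ε > 0`, the inequality `r i ≥ ε * m i` holds for infinitely many `i`. -/
def HasSolovayProperty (m : ℕ → ℝ) (r : ℕ → ℚ) : Prop :=
  ∃ ε : ℝ, 0 < ε ∧ {i : ℕ | ε * m i ≤ (r i : ℝ)}.Infinite

/-! Since every `m i` is positive, the Solovay property fails exactly when `r i / m i` tends to 0,
so it suffices to match this limit with non-randomness.

If the ratios tend to 0, the tails of `∑ r` are eventually below any constant `c > 0` times the
tails of `∑ m`. A computable point tries to overtake the sum α: it grows by `c` times the increments
of an approximation β of `∑ m` from below, and jumps up to the partial sum whenever it falls behind.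
It eventually passes α, and does so by growing, because partial sums stay below α. The stretches
covered while growing have total length at most `c`, so they form a test
(`not_isMartinLofRandom_of_fast`).

Conversely, let a test `U` capture α. Give `[s i, s (i + 1)]`, of length `r i`, the extra weight `2
^ n * r i` for each `n` such that a single interval of `U (2 * n + 1)` covers it. The measure bounds
make this a semimeasure. Each of these open sets contains α, hence covers almost all of the
segments, so maximality of `m` gives `2 ^ n * r i ≤ C * m i` for all large `i`. -/

/-! ### Arithmetic, comparison and recursion for computable rationals -/

namespace IsComputableRat

variable {α β : Type*} [Primcodable α] [Primcodable β]

theorem comp {f : β → ℚ} (hf : IsComputableRat f) {g : α → β} (hg : Computable g) :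
    IsComputableRat fun x => f (g x) := by
  obtain ⟨a, b, d, ha, hb, hd, h⟩ := hf
  exact ⟨_, _, _, ha.comp hg, hb.comp hg, hd.comp hg, fun x => h (g x)⟩

theorem natCast {f : α → ℕ} (hf : Computable f) : IsComputableRat fun x => (f x : ℚ) :=
  ⟨f, fun _ => 0, fun _ => 0, hf, Computable.const 0, Computable.const 0, fun x => by simp⟩

theorem natAdd {f g : α → ℕ} (hf : Computable f) (hg : Computable g) :
    Computable fun x => f x + g x :=
  Primrec.nat_add.to_comp.comp hf hg

theorem natMul {f g : α → ℕ} (hf : Computable f) (hg : Computable g) :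
    Computable fun x => f x * g x :=
  Primrec.nat_mul.to_comp.comp hf hg

theorem natPow (c : ℕ) {f : α → ℕ} (hf : Computable f) : Computable fun x => c ^ f x := by
  have h : Computable fun n : ℕ => c ^ n := by
    refine (Computable.nat_rec (f := fun n : ℕ => n) (g := fun _ => 1)
      (h := fun _ p => p.2 * c) Computable.id (Computable.const 1)
      (natMul (Computable.snd.comp Computable.snd) (Computable.const c)).to₂).of_eq fun n => ?_
    induction n with
    | zero => rfl
    | succ n ih => simpa [pow_succ] using Or.inl ih
  exact h.comp hf

theorem add {f g : α → ℚ} (hf : IsComputableRat f) (hg : IsComputableRat g) :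
    IsComputableRat fun x => f x + g x := by
  obtain ⟨a, b, d, ha, hb, hd, h⟩ := hf
  obtain ⟨a', b', d', ha', hb', hd', h'⟩ := hg
  refine ⟨fun x => a x * (d' x + 1) + a' x * (d x + 1),
    fun x => b x * (d' x + 1) + b' x * (d x + 1), fun x => d x * d' x + (d x + d' x),
    natAdd (natMul ha (natAdd hd' (.const 1))) (natMul ha' (natAdd hd (.const 1))),
    natAdd (natMul hb (natAdd hd' (.const 1))) (natMul hb' (natAdd hd (.const 1))),
    natAdd (natMul hd hd') (natAdd hd hd'), fun x => ?_⟩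
  have e : ((d x * d' x + (d x + d' x) : ℕ) : ℚ) + 1 = ((d x : ℚ) + 1) * ((d' x : ℚ) + 1) := by
    push_cast; ring
  beta_reduce
  rw [h, h', e]
  push_cast
  field_simp
  ring

theorem mul {f g : α → ℚ} (hf : IsComputableRat f) (hg : IsComputableRat g) :
    IsComputableRat fun x => f x * g x := by
  obtain ⟨a, b, d, ha, hb, hd, h⟩ := hf
  obtain ⟨a', b', d', ha', hb', hd', h'⟩ := hg
  refine ⟨fun x => a x * a' x + b x * b' x, fun x => a x * b' x + b x * a' x,
    fun x => d x * d' x + (d x + d' x),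
    natAdd (natMul ha ha') (natMul hb hb'), natAdd (natMul ha hb') (natMul hb ha'),
    natAdd (natMul hd hd') (natAdd hd hd'), fun x => ?_⟩
  have e : ((d x * d' x + (d x + d' x) : ℕ) : ℚ) + 1 = ((d x : ℚ) + 1) * ((d' x : ℚ) + 1) := by
    push_cast; ring
  beta_reduce
  rw [h, h', e]
  push_cast
  field_simp
  ring

theorem neg {f : α → ℚ} (hf : IsComputableRat f) : IsComputableRat fun x => -f x := by
  obtain ⟨a, b, d, ha, hb, hd, h⟩ := hf
  exact ⟨b, a, d, hb, ha, hd, fun x => by beta_reduce; rw [h, ← neg_div, neg_sub]⟩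

theorem sub {f g : α → ℚ} (hf : IsComputableRat f) (hg : IsComputableRat g) :
    IsComputableRat fun x => f x - g x := by
  simpa only [sub_eq_add_neg] using hf.add hg.neg

theorem inv_two_pow {f : α → ℕ} (hf : Computable f) :
    IsComputableRat fun x => (2⁻¹ : ℚ) ^ f x := by
  refine ⟨fun _ => 1, fun _ => 0, fun x => 2 ^ f x - 1, .const 1, .const 0,
    Primrec.nat_sub.to_comp.comp (natPow 2 hf) (.const 1), fun x => ?_⟩
  simp [Nat.cast_sub Nat.one_le_two_pow]

theorem ite_lt {f g u v : α → ℚ} (hf : IsComputableRat f) (hg : IsComputableRat g)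
    (hu : IsComputableRat u) (hv : IsComputableRat v) :
    IsComputableRat fun x => if f x < g x then u x else v x := by
  obtain ⟨a, b, d, ha, hb, hd, h⟩ := hf
  obtain ⟨a', b', d', ha', hb', hd', h'⟩ := hg
  obtain ⟨p, q, e, hp, hq, he, hu⟩ := hu
  obtain ⟨p', q', e', hp', hq', he', hv⟩ := hv
  -- Cross-multiplied, with the negative terms moved across, the comparison takes place in `ℕ`.
  let c : α → Bool := fun x =>
    decide (a x * (d' x + 1) + b' x * (d x + 1) < a' x * (d x + 1) + b x * (d' x + 1))
  have hc : Computable c :=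
    Primrec.nat_lt.decide.to_comp.comp
      (natAdd (natMul ha (natAdd hd' (.const 1))) (natMul hb' (natAdd hd (.const 1))))
      (natAdd (natMul ha' (natAdd hd (.const 1))) (natMul hb (natAdd hd' (.const 1))))
  have key : ∀ x, f x < g x ↔ c x = true := fun x => by
    rw [h, h', div_lt_div_iff₀ (by positivity) (by positivity), decide_eq_true_iff,
      ← Nat.cast_lt (α := ℚ)]
    push_cast
    constructor <;> intro hx <;> linarith
  refine ⟨_, _, _, Computable.cond hc hp hp', Computable.cond hc hq hq',
    Computable.cond hc he he', fun x => ?_⟩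
  by_cases hx : f x < g x
  · simp only [if_pos hx, (key x).1 hx, cond_true, hu]
  · have : c x = false := by simpa using mt (key x).2 hx
    simp only [if_neg hx, this, cond_false, hv]

theorem max {f g : α → ℚ} (hf : IsComputableRat f) (hg : IsComputableRat g) :
    IsComputableRat fun x => Max.max (f x) (g x) := by
  simpa only [max_def_lt] using hf.ite_lt hg hg hf

/-- The rational represented by a triple of natural numbers. -/
def ofTriple (t : ℕ × ℕ × ℕ) : ℚ := ((t.1 : ℚ) - (t.2.1 : ℚ)) / ((t.2.2 : ℚ) + 1)

theorem ofTriple_isComputableRat : IsComputableRat ofTriple :=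
  ⟨_, _, _, .fst, Computable.fst.comp .snd, Computable.snd.comp .snd, fun _ => rfl⟩

/-- An operation on rationals that is computable on triples can be iterated along a computable
sequence. -/
theorem natRec {op : ℚ → ℚ → ℚ}
    (hop : IsComputableRat fun p : (ℕ × ℕ × ℕ) × (ℕ × ℕ × ℕ) => op (ofTriple p.1) (ofTriple p.2))
    {g : α → ℚ} (hg : IsComputableRat g) {h : α → ℕ → ℚ}
    (hh : IsComputableRat fun p : α × ℕ => h p.1 p.2) {n : α → ℕ} (hn : Computable n) :
    IsComputableRat fun x => Nat.rec (motive := fun _ => ℚ) (g x) (fun k s => op s (h x k)) (n x) := by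
  obtain ⟨oa, ob, od, hoa, hob, hod, ho⟩ := hop
  obtain ⟨a, b, d, ha, hb, hd, hg⟩ := hg
  obtain ⟨a', b', d', ha', hb', hd', hh⟩ := hh
  let G : α → ℕ × ℕ × ℕ := fun x => (a x, b x, d x)
  let H : α × ℕ → ℕ × ℕ × ℕ := fun p => (a' p, b' p, d' p)
  let O : (ℕ × ℕ × ℕ) × (ℕ × ℕ × ℕ) → ℕ × ℕ × ℕ := fun p => (oa p, ob p, od p)
  have hO : Computable O := hoa.pair (hob.pair hod)
  have hH : Computable H := ha'.pair (hb'.pair hd')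
  have hG : Computable G := ha.pair (hb.pair hd)
  -- The iteration runs on representing triples, which need not be reduced; they are evaluated only
  -- at the end.
  let R : α → ℕ → ℕ × ℕ × ℕ := fun x k =>
    Nat.rec (motive := fun _ => ℕ × ℕ × ℕ) (G x) (fun k s => O (s, H (x, k))) k
  have hR : Computable fun x => R x (n x) :=
    Computable.nat_rec (h := fun x (p : ℕ × ℕ × ℕ × ℕ) => O (p.2, H (x, p.1))) hn hG
      (hO.comp ((Computable.snd.comp .snd).pair
        (hH.comp (Computable.fst.pair (Computable.fst.comp .snd))))).to₂
  have key : ∀ x k, Nat.rec (motive := fun _ => ℚ) (g x) (fun k s => op s (h x k)) k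
      = ofTriple (R x k) := fun x k => by
    induction k with
    | zero => exact hg x
    | succ k ih =>
      have h1 : h x k = ofTriple (H (x, k)) := hh (x, k)
      have h2 : R x (k + 1) = O (R x k, H (x, k)) := rfl
      have h3 := ho (R x k, H (x, k))
      simp only [ih, h1, h2]
      exact h3
  simpa only [key] using ofTriple_isComputableRat.comp hR

theorem sum_range {h : α → ℕ → ℚ} (hh : IsComputableRat fun p : α × ℕ => h p.1 p.2)
    {n : α → ℕ} (hn : Computable n) :
    IsComputableRat fun x => ∑ k ∈ Finset.range (n x), h x k := by
  have key : ∀ x k, Nat.rec (motive := fun _ => ℚ) (0 : ℚ) (fun k s => s + h x k) k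
      = ∑ k ∈ Finset.range k, h x k := fun x k => by
    induction k with
    | zero => rfl
    | succ k ih => rw [Finset.sum_range_succ, ← ih]
  have := natRec (op := (· + ·)) ((ofTriple_isComputableRat.comp .fst).add
    (ofTriple_isComputableRat.comp .snd)) (natCast (.const (α := α) 0)) hh hn
  simpa only [Nat.cast_zero, key] using this

end IsComputableRat

/-! ### A test from a fast approximation -/

theorem sum_range_inv_two_pow_le (T : ℕ) : ∑ t ∈ Finset.range T, (2⁻¹ : ℚ) ^ t ≤ 2 := by
  have h : ∑ t ∈ Finset.range T, (2⁻¹ : ℝ) ^ t ≤ 2 := by simpa using sum_geometric_two_le T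
  rw [← Rat.cast_le (K := ℝ)]
  push_cast
  exact h

/-- The running maximum of `s u - c * β u` over `u ≤ t`. -/
def runningMax (s β : ℕ → ℚ) (c : ℚ) (t : ℕ) : ℚ :=
  Nat.rec (motive := fun _ => ℚ) (s 0 - c * β 0)
    (fun k M => max M (s (k + 1) - c * β (k + 1))) t

theorem le_runningMax (s β : ℕ → ℚ) (c : ℚ) {u t : ℕ} (h : u ≤ t) :
    s u - c * β u ≤ runningMax s β c t := by
  induction t with
  | zero => obtain rfl : u = 0 := by omega
            exact le_rfl
  | succ t ih =>
    rcases Nat.lt_or_ge t u with h' | h'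
    · obtain rfl : u = t + 1 := by omega
      exact le_max_right _ _
    · exact (ih h').trans (le_max_left _ _)

/-- If the increasing approximations `s` of `x` converge much faster than those of some bounded
increasing computable sequence `β`, then `x` is not Martin-Löf random. -/
theorem not_isMartinLofRandom_of_fast {s β : ℕ → ℚ} {x : ℝ} (hs : IsComputableRat s)
    (hβ : IsComputableRat β) (hsx : ∀ t, (s t : ℝ) < x) (hmono : Monotone β)
    (h0 : ∀ t, 0 ≤ β t) (h1 : ∀ t, β t ≤ 1)
    (hfast : ∀ n : ℕ, ∃ N T, N ≤ T ∧
      x < (s N : ℝ) + (2⁻¹ : ℝ) ^ (n + 2) * ((β T : ℝ) - (β N : ℝ))) :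
    ¬ IsMartinLofRandom x := by
  let c : ℕ → ℚ := fun n => (2⁻¹ : ℚ) ^ (n + 2)
  let P : ℕ → ℕ → ℚ := fun n t => runningMax s β (c n) t
  -- The moving point is `e t = P n t + c n * β t`, and `e (t + 1)` is the maximum of `b n t` and `s
  -- (t + 1)`. The margin `c n * 2⁻¹ ^ t` puts `e t` itself inside the open interval. Increments of
  -- β sum to at most 1 and margins to at most 2, so the total is below `4 * c n = 2⁻¹ ^ n`.
  let a : ℕ → ℕ → ℚ := fun n t => P n t + c n * β t - c n * (2⁻¹ : ℚ) ^ t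
  let b : ℕ → ℕ → ℚ := fun n t => P n t + c n * β (t + 1)
  have cc : IsComputableRat c := .inv_two_pow (Computable.succ.comp .succ)
  have cP : IsComputableRat fun p : ℕ × ℕ => P p.1 p.2 := by
    refine IsComputableRat.natRec (op := max)
      (h := fun (p : ℕ × ℕ) k => s (k + 1) - c p.1 * β (k + 1))
      ((IsComputableRat.ofTriple_isComputableRat.comp .fst).max
        (IsComputableRat.ofTriple_isComputableRat.comp .snd))
      ((hs.comp (.const 0)).sub ((cc.comp .fst).mul (hβ.comp (.const 0)))) ?_ .snd
    exact (hs.comp (Computable.succ.comp .snd)).sub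
      ((cc.comp (Computable.fst.comp .fst)).mul (hβ.comp (Computable.succ.comp .snd)))
  have ca : IsComputableRat fun p : ℕ × ℕ => a p.1 p.2 :=
    (cP.add ((cc.comp .fst).mul (hβ.comp .snd))).sub
      ((cc.comp .fst).mul (IsComputableRat.inv_two_pow .snd))
  have cb : IsComputableRat fun p : ℕ × ℕ => b p.1 p.2 :=
    cP.add ((cc.comp .fst).mul (hβ.comp (Computable.succ.comp .snd)))
  have cpos : ∀ n, 0 < c n := fun n => by positivity
  intro hx
  refine hx (fun n => ⋃ k, Set.Ioo (a n k : ℝ) (b n k : ℝ)) ⟨⟨a, b, ca, cb, fun n => rfl⟩, ?_⟩ ?_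
  · intro n
    have hlen : ∀ t, (b n t : ℝ) - a n t = ((c n * (β (t + 1) - β t + (2⁻¹ : ℚ) ^ t) : ℚ) : ℝ) := by
      intro t
      rw [← Rat.cast_sub]
      congr 1
      simp only [a, b]
      ring
    refine (measure_iUnion_le _).trans (ENNReal.tsum_le_of_sum_range_le fun T => ?_)
    simp only [Real.volume_Ioo, hlen]
    rw [← ENNReal.ofReal_sum_of_nonneg]
    · rw [← Rat.cast_sum]
      have e : ∑ t ∈ Finset.range T, c n * (β (t + 1) - β t + (2⁻¹ : ℚ) ^ t) ≤ (2⁻¹ : ℚ) ^ n := by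
        rw [← Finset.mul_sum, Finset.sum_add_distrib, Finset.sum_range_sub]
        have : β T - β 0 + ∑ t ∈ Finset.range T, (2⁻¹ : ℚ) ^ t ≤ 4 := by
          linarith [h1 T, h0 0, sum_range_inv_two_pow_le T]
        calc _ ≤ c n * 4 := mul_le_mul_of_nonneg_left this (cpos n).le
          _ = _ := by simp only [c]; ring
      calc _ ≤ ENNReal.ofReal (((2⁻¹ : ℚ) ^ n : ℚ) : ℝ) :=
            ENNReal.ofReal_le_ofReal (by exact_mod_cast e)
        _ = _ := by
            push_cast
            rw [ENNReal.ofReal_pow (by norm_num), ENNReal.ofReal_inv_of_pos (by norm_num)]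
            simp
    · intro t _
      have : β t ≤ β (t + 1) := hmono t.le_succ
      have : 0 ≤ β (t + 1) - β t := by linarith
      have := cpos n
      positivity
  · refine Set.mem_iInter.2 fun n => Set.mem_iUnion.2 ?_
    have hex : ∃ t, x < ((P n t + c n * β t : ℚ) : ℝ) := by
      obtain ⟨N, T, hNT, h⟩ := hfast n
      refine ⟨T, h.trans_le ?_⟩
      have := le_runningMax s β (c n) hNT
      have e : s N + (2⁻¹ : ℚ) ^ (n + 2) * (β T - β N) ≤ P n T + c n * β T := by
        simp only [P]
        simp only [c] at *
        linarith
      have e' := (Rat.cast_le (K := ℝ)).2 e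
      push_cast at e' ⊢
      exact e'
    classical
    -- At time 0 the point is `s 0 < x`, so the first passage beyond `x` is at a successor.
    obtain ⟨t, ht⟩ : ∃ t, Nat.find hex = t + 1 := by
      refine Nat.exists_eq_succ_of_ne_zero fun h => ?_
      have := Nat.find_spec hex
      rw [h] at this
      have e : P n 0 + c n * β 0 = s 0 := by simp [P, runningMax]
      rw [e] at this
      exact absurd (hsx 0) this.not_gt
    have hlt := Nat.find_spec hex
    have hge := not_lt.1 (Nat.find_min hex (m := t) (by omega))
    rw [ht] at hlt
    refine ⟨t, ?_, ?_⟩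
    · refine lt_of_lt_of_le ?_ hge
      have : a n t < P n t + c n * β t := by
        have : 0 < c n * (2⁻¹ : ℚ) ^ t := by have := cpos n; positivity
        simp only [a]
        linarith
      exact_mod_cast this
    · have e : P n (t + 1) + c n * β (t + 1) = max (b n t) (s (t + 1)) := by
        simp only [P, b]
        rw [show runningMax s β (c n) (t + 1) = max (runningMax s β (c n) t)
          (s (t + 1) - c n * β (t + 1)) from rfl, max_add]
        congr 1
        ring
      rw [e, Rat.cast_max, lt_max_iff] at hlt
      exact hlt.resolve_right (hsx _).not_gt

/-! ### Vanishing ratios imply non-randomness -/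

theorem IsComputableRat.partialSums {r : ℕ → ℚ} (hr : IsComputableRat r) :
    IsComputableRat fun t => ∑ i ∈ Finset.range t, r i :=
  IsComputableRat.sum_range (h := fun _ k => r k) (hr.comp .snd) .id

theorem partialSums_lt_tsum {r : ℕ → ℚ} (hpos : ∀ i, 0 < r i)
    (hsum : Summable fun i => (r i : ℝ)) (t : ℕ) :
    ((∑ i ∈ Finset.range t, r i : ℚ) : ℝ) < ∑' i, (r i : ℝ) := by
  push_cast
  have h : ∑ i ∈ Finset.range (t + 1), (r i : ℝ) ≤ ∑' i, (r i : ℝ) :=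
    hsum.sum_le_tsum _ fun i _ => by exact_mod_cast (hpos i).le
  rw [Finset.sum_range_succ] at h
  have : (0 : ℝ) < r t := by exact_mod_cast hpos t
  linarith

/-- Dovetailing: `β t` adds the stage-`t` approximations of the first `t` values. The bound by the
partial sum guarantees that, beyond stage `N`, β still has to gain at least the tail of `m` from `N`
on. -/
theorem IsLowerSemicomputableSemimeasure.exists_approx_tsum {m : ℕ → ℝ}
    (hm : IsLowerSemicomputableSemimeasure m) :
    ∃ β : ℕ → ℚ, IsComputableRat β ∧ Monotone β ∧ (∀ t, 0 ≤ β t) ∧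
      (∀ t, (β t : ℝ) ≤ ∑ i ∈ Finset.range t, m i) ∧
      Tendsto (fun t => (β t : ℝ)) atTop (𝓝 (∑' i, m i)) := by
  obtain ⟨q, hq, hlim⟩ := hm.lowerSemicomputable
  -- The given approximations may start out negative, which would spoil monotonicity when new terms
  -- enter.
  let p : ℕ → ℕ → ℚ := fun i t => max (q i t) 0
  have pmono : ∀ i, Monotone (p i) := fun i a b h => max_le_max ((hlim i).1 h) le_rfl
  have p0 : ∀ i t, 0 ≤ p i t := fun i t => le_max_right _ _
  have ptend : ∀ i, Tendsto (fun t => (p i t : ℝ)) atTop (𝓝 (m i)) := fun i => by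
    have := (hlim i).2.max (tendsto_const_nhds (x := (0 : ℝ)))
    rw [max_eq_left (hm.nonneg i)] at this
    simpa [p] using this
  have ple : ∀ i t, (p i t : ℝ) ≤ m i := fun i t =>
    Monotone.ge_of_tendsto (fun a b h => by exact_mod_cast pmono i h) (ptend i) t
  have hle : ∀ t, ((∑ i ∈ Finset.range t, p i t : ℚ) : ℝ) ≤ ∑ i ∈ Finset.range t, m i := fun t => by
    push_cast
    exact Finset.sum_le_sum fun i _ => ple i t
  refine ⟨fun t => ∑ i ∈ Finset.range t, p i t, ?_, ?_, ?_, hle, ?_⟩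
  · refine IsComputableRat.sum_range (h := fun t i => p i t) ?_ .id
    exact (hq.comp (Computable.snd.pair .fst)).max
      ((IsComputableRat.natCast (.const 0)).comp (β := ℕ × ℕ) .id)
  · intro a b h
    calc ∑ i ∈ Finset.range a, p i a ≤ ∑ i ∈ Finset.range a, p i b :=
          Finset.sum_le_sum fun i _ => pmono i h
      _ ≤ _ := Finset.sum_le_sum_of_subset_of_nonneg (Finset.range_mono h) fun i _ _ => p0 i b
  · exact fun t => Finset.sum_nonneg fun i _ => p0 i t
  · refine tendsto_order.2 ⟨fun y hy => ?_, fun y hy => Eventually.of_forall fun t =>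
      ((hle t).trans (hm.summable.sum_le_tsum _ fun i _ => hm.nonneg i)).trans_lt hy⟩
    obtain ⟨k, hk⟩ := ((tendsto_order.1 hm.summable.hasSum.tendsto_sum_nat).1 y hy).exists
    have ht : Tendsto (fun t => ∑ i ∈ Finset.range k, (p i t : ℝ)) atTop
        (𝓝 (∑ i ∈ Finset.range k, m i)) := tendsto_finsetSum _ fun i _ => ptend i
    filter_upwards [(tendsto_order.1 ht).1 y hk, eventually_ge_atTop k] with t h1 h2
    refine h1.trans_le ?_
    push_cast
    exact Finset.sum_le_sum_of_subset_of_nonneg (Finset.range_mono h2)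
      fun i _ _ => by exact_mod_cast p0 i t

theorem not_isMartinLofRandom_of_tendsto {r : ℕ → ℚ} (hr : IsComputableRat r)
    (hpos : ∀ i, 0 < r i) (hsum : Summable fun i => (r i : ℝ)) {m : ℕ → ℝ}
    (hm : IsLowerSemicomputableSemimeasure m) (hmpos : ∀ i, 0 < m i)
    (h : Tendsto (fun i => (r i : ℝ) / m i) atTop (𝓝 0)) :
    ¬ IsMartinLofRandom (∑' i, (r i : ℝ)) := by
  obtain ⟨β, hβ, hmono, h0, hle, hlim⟩ := hm.exists_approx_tsum
  refine not_isMartinLofRandom_of_fast hr.partialSums hβ (partialSums_lt_tsum hpos hsum)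
    hmono h0 (fun t => ?_) fun n => ?_
  · have : (β t : ℝ) ≤ 1 := (hle t).trans
      ((hm.summable.sum_le_tsum _ fun i _ => hm.nonneg i).trans hm.tsum_le_one)
    exact_mod_cast this
  -- The exponent is `n + 3` because β is only awaited until it has gained half of the tail of `m`.
  · obtain ⟨N, hN⟩ := eventually_atTop.1
      ((tendsto_order.1 h).2 ((2⁻¹ : ℝ) ^ (n + 3)) (by positivity))
    have hr' : Summable fun i => (r (i + N) : ℝ) :=
      (summable_nat_add_iff (f := fun i => (r i : ℝ)) N).2 hsum
    have hm' : Summable fun i => m (i + N) := (summable_nat_add_iff N).2 hm.summable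
    have hM : 0 < ∑' i, m (i + N) := hm'.tsum_pos (fun i => hm.nonneg _) 0 (hmpos _)
    have hα := hsum.sum_add_tsum_nat_add N
    have hS := hm.summable.sum_add_tsum_nat_add N
    have htail : ∑' i, (r (i + N) : ℝ) ≤ (2⁻¹ : ℝ) ^ (n + 3) * ∑' i, m (i + N) := by
      rw [← tsum_mul_left]
      refine hr'.tsum_le_tsum (fun i => ?_) (hm'.mul_left _)
      exact ((div_lt_iff₀ (hmpos _)).1 (hN (i + N) (by omega))).le
    obtain ⟨T, hT, hNT⟩ := (((tendsto_order.1 hlim).1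
      (∑' i, m i - (∑' i, m (i + N)) / 2) (by linarith)).and (eventually_ge_atTop N)).exists
    refine ⟨N, T, hNT, ?_⟩
    push_cast
    have hd : (∑' i, m (i + N)) / 2 < (β T : ℝ) - β N := by linarith [hle N]
    have : (2⁻¹ : ℝ) ^ (n + 2) * ((∑' i, m (i + N)) / 2) <
        (2⁻¹ : ℝ) ^ (n + 2) * ((β T : ℝ) - β N) := by gcongr
    rw [pow_succ] at htail
    linarith

/-! ### A semimeasure from a test -/

theorem sum_ofReal_le_volume_of_Ioo_subset {s : ℕ → ℝ} (hs : Monotone s) {U : Set ℝ}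
    (F : Finset ℕ) (hF : ∀ i ∈ F, Set.Ioo (s i) (s (i + 1)) ⊆ U) :
    ENNReal.ofReal (∑ i ∈ F, (s (i + 1) - s i)) ≤ volume U := by
  rw [ENNReal.ofReal_sum_of_nonneg fun i _ => sub_nonneg.2 (hs i.le_succ)]
  simp only [← Real.volume_Ioo]
  rw [← measure_biUnion_finset]
  · exact measure_mono (Set.iUnion₂_subset hF)
  · exact fun i _ j _ hij => hs.pairwise_disjoint_on_Ioo_succ hij
  · exact fun _ _ => measurableSet_Ioo

/-- The supremum of a computable monotone family of nonnegative rationals, all of whose finite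
sums are at most one, is a lower semicomputable semimeasure. -/
theorem exists_isLowerSemicomputableSemimeasure {q : ℕ → ℕ → ℚ}
    (hq : IsComputableRat fun p : ℕ × ℕ => q p.1 p.2) (hmono : ∀ i, Monotone (q i))
    (h0 : ∀ i t, 0 ≤ q i t) (h1 : ∀ I t, ∑ i ∈ Finset.range I, q i t ≤ 1) :
    ∃ m : ℕ → ℝ, IsLowerSemicomputableSemimeasure m ∧ ∀ i t, (q i t : ℝ) ≤ m i := by
  have hle : ∀ i t, q i t ≤ 1 := fun i t =>
    (Finset.single_le_sum (f := fun i => q i t) (fun j _ => h0 j t)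
      (Finset.self_mem_range_succ i)).trans (h1 (i + 1) t)
  have hbdd : ∀ i, BddAbove (Set.range fun t => (q i t : ℝ)) := fun i =>
    ⟨1, by rintro _ ⟨t, rfl⟩; beta_reduce; exact_mod_cast hle i t⟩
  have hlim : ∀ i, Tendsto (fun t => (q i t : ℝ)) atTop (𝓝 (⨆ t, (q i t : ℝ))) := fun i =>
    tendsto_atTop_ciSup (fun a b h => by exact_mod_cast hmono i h) (hbdd i)
  have hge : ∀ i t, (q i t : ℝ) ≤ ⨆ t, (q i t : ℝ) := fun i t => le_ciSup (hbdd i) t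
  have hnn : ∀ i, 0 ≤ ⨆ t, (q i t : ℝ) := fun i =>
    le_trans (by exact_mod_cast h0 i 0) (hge i 0)
  have hsum : ∀ I, ∑ i ∈ Finset.range I, ⨆ t, (q i t : ℝ) ≤ 1 := fun I =>
    le_of_tendsto' (tendsto_finsetSum _ fun i _ => hlim i) fun t => by exact_mod_cast h1 I t
  exact ⟨fun i => ⨆ t, (q i t : ℝ), ⟨⟨q, hq, fun i => ⟨hmono i, hlim i⟩⟩, hnn,
    summable_of_sum_range_le hnn hsum, Real.tsum_le_of_sum_range_le hnn hsum⟩, hge⟩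

/-- Up to a constant, `m` dominates a semimeasure that is at least `2⁻¹ ^ (i + 1)` at every `i`. -/
theorem IsUniversalSemimeasure.pos {m : ℕ → ℝ} (hm : IsUniversalSemimeasure m) (i : ℕ) :
    0 < m i := by
  obtain ⟨m', hm', hle⟩ := exists_isLowerSemicomputableSemimeasure
    (q := fun i _ => (2⁻¹ : ℚ) ^ (i + 1))
    (IsComputableRat.inv_two_pow (Computable.succ.comp .fst)) (fun i => monotone_const)
    (fun i t => by positivity) (fun I t => by
      simp only [pow_succ]
      rw [← Finset.sum_mul]
      linarith [sum_range_inv_two_pow_le I])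
  obtain ⟨C, hC, h⟩ := hm.maximal m' hm'
  have h1 : (0 : ℝ) < m' i := lt_of_lt_of_le (by positivity) (hle i 0)
  exact pos_of_mul_pos_right (h1.trans_le (h i)) hC.le

/-- The indicator of the event that the `k`-th interval `(a n k, b n k)` of the `n`-th set covers
`[s i, s (i + 1)]`. -/
def coverIndicator (a b : ℕ → ℕ → ℚ) (s : ℕ → ℚ) (i n k : ℕ) : ℚ :=
  if a n k < s i then (if s (i + 1) < b n k then 1 else 0) else 0

/-- The indicator of the event that one of the first `t` intervals of the `n`-th set covers
`[s i, s (i + 1)]`. -/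
def coverIndicatorBefore (a b : ℕ → ℕ → ℚ) (s : ℕ → ℚ) (i n t : ℕ) : ℚ :=
  if 0 < ∑ k ∈ Finset.range t, coverIndicator a b s i n k then 1 else 0

/-- The weight of `[s i, s (i + 1)]` at time `t`: its length, counted `2 ^ n` times for every `n < t`
such that it was seen to be covered by the set with number `2 * n + 1`. -/
def coverWeight (a b : ℕ → ℕ → ℚ) (r s : ℕ → ℚ) (i t : ℕ) : ℚ :=
  r i * ∑ n ∈ Finset.range t, 2 ^ n * coverIndicatorBefore a b s i (2 * n + 1) t

section Cover

variable {a b : ℕ → ℕ → ℚ} {r s : ℕ → ℚ}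

theorem coverIndicator_nonneg (i n k : ℕ) : 0 ≤ coverIndicator a b s i n k := by
  unfold coverIndicator
  split_ifs <;> simp

theorem coverIndicatorBefore_nonneg (i n t : ℕ) : 0 ≤ coverIndicatorBefore a b s i n t := by
  unfold coverIndicatorBefore
  split_ifs <;> simp

theorem coverIndicatorBefore_mono (i n : ℕ) : Monotone (coverIndicatorBefore a b s i n) := by
  intro t t' h
  have hS : ∑ k ∈ Finset.range t, coverIndicator a b s i n k ≤
      ∑ k ∈ Finset.range t', coverIndicator a b s i n k :=
    Finset.sum_le_sum_of_subset_of_nonneg (Finset.range_mono h)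
      fun k _ _ => coverIndicator_nonneg i n k
  unfold coverIndicatorBefore
  split_ifs with h1 h2
  · exact le_rfl
  · exact absurd (h1.trans_le hS) h2
  · exact zero_le_one
  · exact le_rfl

theorem coverWeight_nonneg (hpos : ∀ i, 0 < r i) (i t : ℕ) : 0 ≤ coverWeight a b r s i t :=
  mul_nonneg (hpos i).le (Finset.sum_nonneg fun _ _ =>
    mul_nonneg (by positivity) (coverIndicatorBefore_nonneg _ _ _))

theorem coverWeight_mono (hpos : ∀ i, 0 < r i) (i : ℕ) : Monotone (coverWeight a b r s i) := by
  intro t t' h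
  refine mul_le_mul_of_nonneg_left ?_ (hpos i).le
  calc ∑ n ∈ Finset.range t, 2 ^ n * coverIndicatorBefore a b s i (2 * n + 1) t
      ≤ ∑ n ∈ Finset.range t, 2 ^ n * coverIndicatorBefore a b s i (2 * n + 1) t' :=
        Finset.sum_le_sum fun n _ =>
          mul_le_mul_of_nonneg_left (coverIndicatorBefore_mono i _ h) (by positivity)
    _ ≤ _ := Finset.sum_le_sum_of_subset_of_nonneg (Finset.range_mono h)
        fun n _ _ => mul_nonneg (by positivity) (coverIndicatorBefore_nonneg _ _ _)

theorem isComputableRat_coverIndicator (ha : IsComputableRat fun p : ℕ × ℕ => a p.1 p.2)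
    (hb : IsComputableRat fun p : ℕ × ℕ => b p.1 p.2) (hs : IsComputableRat s) :
    IsComputableRat fun p : (ℕ × ℕ × ℕ) × ℕ => coverIndicator a b s p.1.1 p.1.2.1 p.2 := by
  have ci : Computable fun p : (ℕ × ℕ × ℕ) × ℕ => p.1.1 := Computable.fst.comp .fst
  have cnk : Computable fun p : (ℕ × ℕ × ℕ) × ℕ => (p.1.2.1, p.2) :=
    (Computable.fst.comp (Computable.snd.comp .fst)).pair .snd
  have c0 : IsComputableRat fun _ : (ℕ × ℕ × ℕ) × ℕ => (0 : ℚ) :=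
    mod_cast IsComputableRat.natCast (.const 0)
  have c1 : IsComputableRat fun _ : (ℕ × ℕ × ℕ) × ℕ => (1 : ℚ) :=
    mod_cast IsComputableRat.natCast (.const 1)
  exact (ha.comp cnk).ite_lt (hs.comp ci)
    ((hs.comp (Computable.succ.comp ci)).ite_lt (hb.comp cnk) c1 c0) c0

theorem isComputableRat_coverIndicatorBefore (ha : IsComputableRat fun p : ℕ × ℕ => a p.1 p.2)
    (hb : IsComputableRat fun p : ℕ × ℕ => b p.1 p.2) (hs : IsComputableRat s) :
    IsComputableRat fun p : ℕ × ℕ × ℕ => coverIndicatorBefore a b s p.1 p.2.1 p.2.2 := by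
  have c0 : IsComputableRat fun _ : ℕ × ℕ × ℕ => (0 : ℚ) :=
    mod_cast IsComputableRat.natCast (.const 0)
  have c1 : IsComputableRat fun _ : ℕ × ℕ × ℕ => (1 : ℚ) :=
    mod_cast IsComputableRat.natCast (.const 1)
  exact c0.ite_lt (IsComputableRat.sum_range
    (h := fun (p : ℕ × ℕ × ℕ) k => coverIndicator a b s p.1 p.2.1 k)
    (isComputableRat_coverIndicator ha hb hs) (Computable.snd.comp .snd)) c1 c0

theorem isComputableRat_coverWeight (ha : IsComputableRat fun p : ℕ × ℕ => a p.1 p.2)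
    (hb : IsComputableRat fun p : ℕ × ℕ => b p.1 p.2) (hs : IsComputableRat s)
    (hr : IsComputableRat r) :
    IsComputableRat fun p : ℕ × ℕ => coverWeight a b r s p.1 p.2 := by
  have h2 : IsComputableRat fun p : (ℕ × ℕ) × ℕ => (2 : ℚ) ^ p.2 :=
    mod_cast IsComputableRat.natCast (IsComputableRat.natPow 2 (.snd (α := ℕ × ℕ) (β := ℕ)))
  have hn : Computable fun p : (ℕ × ℕ) × ℕ => 2 * p.2 + 1 :=
    IsComputableRat.natAdd (IsComputableRat.natMul (.const 2) .snd) (.const 1)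
  have hg : Computable fun p : (ℕ × ℕ) × ℕ => (p.1.1, 2 * p.2 + 1, p.1.2) :=
    (Computable.fst.comp .fst).pair (hn.pair (Computable.snd.comp .fst))
  have h3 : IsComputableRat fun p : (ℕ × ℕ) × ℕ =>
      coverIndicatorBefore a b s p.1.1 (2 * p.2 + 1) p.1.2 := by
    simpa only using (isComputableRat_coverIndicatorBefore ha hb hs).comp hg
  have h4 : IsComputableRat fun p : ℕ × ℕ =>
      ∑ n ∈ Finset.range p.2, 2 ^ n * coverIndicatorBefore a b s p.1 (2 * n + 1) p.2 :=
    IsComputableRat.sum_range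
      (h := fun (p : ℕ × ℕ) n => 2 ^ n * coverIndicatorBefore a b s p.1 (2 * n + 1) p.2)
      (h2.mul h3) .snd
  exact (hr.comp .fst).mul h4

end Cover

theorem tendsto_of_not_isMartinLofRandom {r : ℕ → ℚ} (hr : IsComputableRat r)
    (hpos : ∀ i, 0 < r i) (hsum : Summable fun i => (r i : ℝ)) {m : ℕ → ℝ}
    (hm : IsUniversalSemimeasure m) (h : ¬ IsMartinLofRandom (∑' i, (r i : ℝ))) :
    Tendsto (fun i => (r i : ℝ) / m i) atTop (𝓝 0) := by
  unfold IsMartinLofRandom at h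
  push Not at h
  obtain ⟨U, ⟨⟨a, b, ha, hb, hU⟩, hvol⟩, hx⟩ := h
  set s : ℕ → ℚ := fun t => ∑ i ∈ Finset.range t, r i with hsdef
  have hs : IsComputableRat s := hr.partialSums
  have hsucc : ∀ i, s (i + 1) - s i = r i := fun i => by simp [s, Finset.sum_range_succ]
  have smono : Monotone s := monotone_nat_of_le_succ fun i => by linarith [hsucc i, hpos i]
  have slt : ∀ i, (s i : ℝ) < ∑' i, (r i : ℝ) := partialSums_lt_tsum hpos hsum
  have slim : Tendsto (fun i => (s i : ℝ)) atTop (𝓝 (∑' i, (r i : ℝ))) := by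
    simpa [s] using hsum.hasSum.tendsto_sum_nat
  -- The covered segments have disjoint interiors contained in `U (2 * n + 1)`, so their total
  -- length is at most its measure.
  have hmeas : ∀ I n t, ∑ i ∈ Finset.range I, r i * coverIndicatorBefore a b s i (2 * n + 1) t ≤ (2⁻¹ : ℚ) ^ (2 * n + 1) := by
    intro I n t
    have h1 : ∑ i ∈ Finset.range I, r i * coverIndicatorBefore a b s i (2 * n + 1) t = ∑ i ∈ (Finset.range I).filter
        (fun i => 0 < ∑ k ∈ Finset.range t, coverIndicator a b s i (2 * n + 1) k), (s (i + 1) - s i) := by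
      rw [Finset.sum_filter]
      simp only [coverIndicatorBefore, hsucc, mul_ite, mul_one, mul_zero]
    have h2 := sum_ofReal_le_volume_of_Ioo_subset (s := fun i => (s i : ℝ))
      (fun i j h => Rat.cast_le.2 (smono h)) (U := U (2 * n + 1)) ((Finset.range I).filter
        (fun i => 0 < ∑ k ∈ Finset.range t, coverIndicator a b s i (2 * n + 1) k)) (fun i hi => by
          obtain ⟨k, -, hk⟩ := Finset.exists_ne_zero_of_sum_ne_zero (Finset.mem_filter.1 hi).2.ne'
          have hk' : a (2 * n + 1) k < s i ∧ s (i + 1) < b (2 * n + 1) k := by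
            by_contra hcon
            refine hk ?_
            unfold coverIndicator
            split_ifs with h1 h2
            · exact absurd ⟨h1, h2⟩ hcon
            · rfl
            · rfl
          rw [hU]
          refine Set.subset_iUnion_of_subset k (Set.Ioo_subset_Ioo ?_ ?_)
          · exact_mod_cast hk'.1.le
          · exact_mod_cast hk'.2.le)
    have h3 := h2.trans (hvol _)
    have h4 : (2⁻¹ : ENNReal) ^ (2 * n + 1) = ENNReal.ofReal ((2⁻¹ : ℝ) ^ (2 * n + 1)) := by
      rw [ENNReal.ofReal_pow (by norm_num), ENNReal.ofReal_inv_of_pos (by norm_num)]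
      simp
    rw [h4, ENNReal.ofReal_le_ofReal_iff (by positivity)] at h3
    rw [h1, ← Rat.cast_le (K := ℝ)]
    push_cast
    exact h3
  have q1 : ∀ I t, ∑ i ∈ Finset.range I, coverWeight a b r s i t ≤ 1 := by
    intro I t
    calc ∑ i ∈ Finset.range I, coverWeight a b r s i t
        = ∑ n ∈ Finset.range t, 2 ^ n * ∑ i ∈ Finset.range I, r i * coverIndicatorBefore a b s i (2 * n + 1) t := by
          simp only [coverWeight, Finset.mul_sum]
          rw [Finset.sum_comm]
          exact Finset.sum_congr rfl fun n _ => Finset.sum_congr rfl fun i _ => by ring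
      _ ≤ ∑ n ∈ Finset.range t, 2 ^ n * (2⁻¹ : ℚ) ^ (2 * n + 1) :=
          Finset.sum_le_sum fun n _ => mul_le_mul_of_nonneg_left (hmeas I n t) (by positivity)
      -- The index `2 * n + 1` pays for the factor `2 ^ n`, leaving half of a geometric series.
      _ = (∑ n ∈ Finset.range t, (2⁻¹ : ℚ) ^ n) * 2⁻¹ := by
          rw [Finset.sum_mul]
          refine Finset.sum_congr rfl fun n _ => ?_
          rw [pow_succ, pow_mul', sq, ← mul_assoc, ← mul_assoc, ← mul_pow]
          norm_num
      _ ≤ 1 := by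
          linarith [sum_range_inv_two_pow_le t]
  obtain ⟨m', hm', hge⟩ := exists_isLowerSemicomputableSemimeasure
    (isComputableRat_coverWeight ha hb hs hr) (coverWeight_mono hpos) (coverWeight_nonneg hpos) q1
  obtain ⟨C, hC, hCm⟩ := hm.maximal m' hm'
  have hbig : ∀ n : ℕ, ∀ᶠ i in atTop, 2 ^ n * (r i : ℝ) ≤ m' i := by
    intro n
    have hxn := Set.mem_iInter.1 hx (2 * n + 1)
    rw [hU] at hxn
    obtain ⟨k, hk1, hk2⟩ := Set.mem_iUnion.1 hxn
    -- Once `s i` passes the left end of an interval around α, the whole segment lies inside it,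
    -- since `s (i + 1)` is below α.
    filter_upwards [(tendsto_order.1 slim).1 _ hk1] with i hi
    have h1 : coverIndicator a b s i (2 * n + 1) k = 1 := by
      have h1 : a (2 * n + 1) k < s i := by exact_mod_cast hi
      have h2 : s (i + 1) < b (2 * n + 1) k := by exact_mod_cast (slt (i + 1)).trans hk2
      simp only [coverIndicator, if_pos h1, if_pos h2]
    -- By stage `max k n + 1` both the interval `k` and the level `n` have been taken into account.
    have h2 : coverIndicatorBefore a b s i (2 * n + 1) (max k n + 1) = 1 := by
      refine if_pos (lt_of_lt_of_le zero_lt_one (h1 ▸ ?_))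
      exact Finset.single_le_sum (f := fun k => coverIndicator a b s i (2 * n + 1) k) (fun k _ => coverIndicator_nonneg _ _ _)
        (Finset.mem_range.2 (by omega))
    have h3 : 2 ^ n * r i ≤ coverWeight a b r s i (max k n + 1) := by
      rw [mul_comm]
      refine mul_le_mul_of_nonneg_left ?_ (hpos i).le
      calc (2 : ℚ) ^ n = 2 ^ n * coverIndicatorBefore a b s i (2 * n + 1) (max k n + 1) := by rw [h2, mul_one]
        _ ≤ _ := Finset.single_le_sum (f := fun l => 2 ^ l * coverIndicatorBefore a b s i (2 * l + 1) (max k n + 1))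
            (fun l _ => mul_nonneg (by positivity) (coverIndicatorBefore_nonneg _ _ _)) (Finset.mem_range.2 (by omega))
    exact le_trans (by exact_mod_cast h3) (hge i (max k n + 1))
  refine tendsto_order.2 ⟨fun y hy => Eventually.of_forall fun i => hy.trans_le
    (div_nonneg (by exact_mod_cast (hpos i).le) (hm.pos i).le), fun y hy => ?_⟩
  obtain ⟨n, hn⟩ := pow_unbounded_of_one_lt (C / y) (one_lt_two (α := ℝ))
  filter_upwards [hbig n] with i hi
  rw [div_lt_iff₀ (hm.pos i)]
  rw [div_lt_iff₀ hy] at hn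
  have h1 := hi.trans (hCm i)
  have h2 : C * m i < 2 ^ n * y * m i := by gcongr; exact hm.pos i
  have h3 : (2 : ℝ) ^ n * r i < 2 ^ n * (y * m i) := by linarith
  exact lt_of_mul_lt_mul_left h3 (by positivity)

/-! ### The Solovay property and the main theorem -/

theorem hasSolovayProperty_iff_not_tendsto {r : ℕ → ℚ} (hpos : ∀ i, 0 < r i) {m : ℕ → ℝ}
    (hm : ∀ i, 0 < m i) :
    HasSolovayProperty m r ↔ ¬ Tendsto (fun i => (r i : ℝ) / m i) atTop (𝓝 0) := by
  rw [iff_not_comm]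
  have h0 : ∀ i, 0 ≤ (r i : ℝ) / m i := fun i =>
    div_nonneg (by exact_mod_cast (hpos i).le) (hm i).le
  constructor
  · intro h hS
    obtain ⟨ε, hε, hinf⟩ := hS
    obtain ⟨i, hi, hlt⟩ := ((Nat.frequently_atTop_iff_infinite.2 hinf).and_eventually
      ((tendsto_order.1 h).2 ε hε)).exists
    exact absurd ((div_lt_iff₀ (hm i)).1 hlt) (not_lt.2 hi)
  · intro h
    refine tendsto_order.2 ⟨fun y hy => .of_forall fun i => hy.trans_le (h0 i), fun y hy => ?_⟩
    have hfin : ¬ ∃ᶠ i in atTop, y * m i ≤ (r i : ℝ) := fun hf =>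
      h ⟨y, hy, Nat.frequently_atTop_iff_infinite.1 hf⟩
    filter_upwards [not_frequently.1 hfin] with i hi
    exact (div_lt_iff₀ (hm i)).2 (not_le.1 hi)

theorem mainTheorem7 (r : ℕ → ℚ) (hr : IsComputableRat r) (hpos : ∀ i, 0 < r i)
    (hsum : Summable fun i => (r i : ℝ)) (m : ℕ → ℝ) (hm : IsUniversalSemimeasure m) :
    (IsMartinLofRandom (∑' i, (r i : ℝ)) ↔ HasSolovayProperty m r) ∧
    (¬ IsMartinLofRandom (∑' i, (r i : ℝ)) ↔
      Tendsto (fun i => (r i : ℝ) / m i) atTop (𝓝 0)) := by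
  have h : ¬ IsMartinLofRandom (∑' i, (r i : ℝ)) ↔
      Tendsto (fun i => (r i : ℝ) / m i) atTop (𝓝 0) :=
    ⟨tendsto_of_not_isMartinLofRandom hr hpos hsum hm,
      not_isMartinLofRandom_of_tendsto hr hpos hsum hm.isSemimeasure hm.pos⟩
  refine ⟨?_, h⟩
  rw [hasSolovayProperty_iff_not_tendsto hpos hm.pos, ← h, not_not]
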